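/- Let $q$ be any prime power, $A=\mathbb{F}_q[t]$, $K=\mathbb{F}_q(t)$, and let $K_\infty=\mathbb{F}_q((1/t))$ be the completion of $K$ at the infinite place. Write $[n]=t^{q^n}-t$. For integers $d\ge 0$ and $s\ge 1$ let $S_d(s)=\sum_a a^{-s}\in K$, the sum being over the monic $a\in A$ of degree $d$. For positive integers $s_1,s_2$ let $$\zeta(s_1,s_2)=\sum_{d=0}^{\infty} S_d(s_1)\sum_{i=0}^{d-1}S_i(s_2)\in K_\infty .$$ **Theorem.** (1) For all integers $n\ge 0$ and $k\ge 1$, $$\zeta(q^{n+k}-q^n,\;q^{n+k}-1)=\frac{[k]^{q^n}}{[n+k]}\;\zeta(q^{n+k}-1,\;q^{n+k}-q^n).$$ (2) Let $k\ge 1$, $1\le s<q$, and let $0\le k_i<k$ and $0\le l_i<k$ for $1\le i\le s$. Then $$\zeta\Big(q^k-\sum_{i=1}^s q^{k_i},\;sq^k-\sum_{i=1}^s q^{l_i}\Big)=\prod_{i=1}^s\frac{[k-k_i]^{q^{k_i}}}{[k-l_i]^{q^{l_i}}}\;\zeta\Big(q^k-\sum_{i=1}^s q^{l_i},\;sq^k-\sum_{i=1}^s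 q^{k_i}\Big).$$ (3) Let $k\ge 1$, $1\le s_1\le s_2\le q$, $s_1\ne q$, and let $0\le k_i<k$ for $1\le i\le s_1$ and $0\le l_j<k$ for $1\le j\le s_2$. Then $$\zeta\Big(q^k-\sum_{i=1}^{s_1} q^{k_i},\;s_2q^k-\sum_{j=1}^{s_2} q^{l_j}\Big)=\prod_{i=1}^{s_1}\frac{[k-k_i]^{q^{k_i}}}{[k-l_i]^{q^{l_i}}}\;\zeta\Big(q^k-\sum_{i=1}^{s_1} q^{l_i},\;s_2q^k-\sum_{j=1}^{s_1} q^{k_j}-\sum_{j=s_1+1}^{s_2} q^{l_j}\Big).$$ -/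

import Mathlib

namespace CarlitzMZV

open Polynomial RatFunc

noncomputable section

variable (F : Type*) [Field F]

/-- There are only finitely many monic polynomials of a given degree over a finite field. -/
theorem finite_monic_natDegree_eq [Finite F] (d : ℕ) :
    {a : F[X] | a.Monic ∧ a.natDegree = d}.Finite := by
  refine Set.Finite.of_injOn (f := fun a (i : Fin (d + 1)) => a.coeff i)
    (t := Set.univ) (fun _ _ => Set.mem_univ _) ?_ Set.finite_univ
  rintro a ⟨-, ha⟩ b ⟨-, hb⟩ hab
  ext i
  by_cases hi : i < d + 1
  · exact congrFun hab ⟨i, hi⟩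
  · rw [coeff_eq_zero_of_natDegree_lt (by omega), coeff_eq_zero_of_natDegree_lt (by omega)]

/-- `A_{d+}`: the finite set of monic polynomials of degree `d` in `A = F[t]`. -/
def monics [Finite F] (d : ℕ) : Finset F[X] := (finite_monic_natDegree_eq F d).toFinset

/-- The power sum `S_d(k) = ∑ 1 / a ^ k` in `K = F(t)`, over the monic `a` of degree `d`. -/
def powerSum [Finite F] (d k : ℕ) : RatFunc F :=
  ∑ a ∈ monics F d, 1 / algebraMap F[X] (RatFunc F) a ^ k

/-- The iterated power sum `S_d(k₁, …, kᵣ) = S_d(k₁) * ∑_{i < d} S_i(k₂, …, kᵣ)` in `K = F(t)`,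
starting from `S_d(k)` in depth one. (The value for the empty tuple is a convention.) -/
def iteratedPowerSum [Finite F] : List ℕ → ℕ → RatFunc F
  | [], d => if d = 0 then 1 else 0
  | [k], d => powerSum F d k
  | k :: k' :: ks, d =>
      powerSum F d k * ∑ i ∈ Finset.range d, iteratedPowerSum (k' :: ks) i

/-- The multizeta value `ζ(s₁, …, sᵣ) = ∑_{d ≥ 0} S_d(s₁, …, sᵣ)` in `K_∞ = F((1/t))`,
the completion of `K = F(t)` at the infinite place. -/
def multizeta [Finite F] [DecidableEq (RatFunc F)] (s : List ℕ) : CompletionAtInfty F :=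
  ∑' d : ℕ, algebraMap (RatFunc F) (CompletionAtInfty F) (iteratedPowerSum F s d)

/-- The element `[n] = t ^ (q ^ n) - t` of `K = F(t)`, where `q` is the cardinality of `F`. -/
def bracket (n : ℕ) : RatFunc F := RatFunc.X ^ (Nat.card F ^ n) - RatFunc.X

section Convergence

theorem mem_monics [Finite F] {d : ℕ} {a : F[X]} :
    a ∈ monics F d ↔ a.Monic ∧ a.natDegree = d := by
  simp [monics]

variable [DecidableEq (RatFunc F)]

open WithZero

theorem valuation_powerSum_le [Finite F] (d k : ℕ) :
    inftyValuation F (powerSum F d k) ≤ exp (-(d * k : ℤ)) := by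
  refine Valuation.map_sum_le _ fun a ha => ?_
  obtain ⟨h1, h2⟩ := (mem_monics F).1 ha
  rw [map_div₀, map_one, map_pow, inftyValuation_apply, inftyValuation.polynomial F h1.ne_zero, h2]
  rw [one_div, ← exp_nsmul, ← exp_neg]
  simp [mul_comm]

theorem valuation_iteratedPowerSum_le [Finite F] (s : List ℕ) (k d : ℕ) :
    inftyValuation F (iteratedPowerSum F (k :: s) d) ≤ exp (-(d * k : ℤ)) := by
  induction s generalizing k d with
  | nil => exact valuation_powerSum_le F d k
  | cons k' s ih =>
    rw [iteratedPowerSum, map_mul]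
    refine (mul_le_mul' (valuation_powerSum_le F d k) (Valuation.map_sum_le (g := 1) _
      fun i _ => (ih k' i).trans ?_)).trans (mul_one _).le
    rw [← exp_zero, exp_le_exp]
    have : (0 : ℤ) ≤ i * k' := by positivity
    omega

theorem valued_algebraMap (x : RatFunc F) :
    Valued.v (algebraMap (RatFunc F) (CompletionAtInfty F) x) = inftyValuation F x :=
  letI := inftyValued F
  Valued.valuedCompletion_apply x

/-- The series defining a multizeta value with positive arguments converges, so that the infinite
sum in the definition of `multizeta` is a genuine one. -/
theorem summable_multizeta [Finite F] (k : ℕ) (s : List ℕ) (hk : 0 < k) :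
    Summable fun d : ℕ =>
      algebraMap (RatFunc F) (CompletionAtInfty F) (iteratedPowerSum F (k :: s) d) := by
  have : CompleteSpace (CompletionAtInfty F) :=
    letI := inftyValued F
    inferInstanceAs (CompleteSpace (UniformSpace.Completion (RatFunc F)))
  have : NonarchimedeanAddGroup (CompletionAtInfty F) :=
    { is_nonarchimedean := fun U hU => by
        obtain ⟨γ, hγ⟩ := Valued.mem_nhds_zero.1 hU
        exact ⟨⟨Valued.v.restrict.ltAddSubgroup γ, Valued.isOpen_ball _ _⟩, hγ⟩ }
  refine NonarchimedeanAddGroup.summable_of_tendsto_cofinite_zero ?_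
  rw [Nat.cofinite_eq_atTop, (Valued.hasBasis_nhds_zero _ _).tendsto_right_iff]
  intro γ _
  set g : ℤᵐ⁰ := MonoidWithZeroHom.ValueGroup₀.embedding γ.1 with hg
  have hg0 : g ≠ 0 := by simp [hg]
  filter_upwards [Filter.eventually_gt_atTop (-log g).toNat] with d hd
  rw [Valuation.restrict_lt_iff_lt_embedding, valued_algebraMap]
  refine (valuation_iteratedPowerSum_le F s k d).trans_lt ?_
  rw [← hg, ← exp_log hg0, exp_lt_exp]
  have : (d : ℤ) ≤ d * k := by
    exact_mod_cast Nat.le_mul_of_pos_right d hk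
  omega

end Convergence

end

end CarlitzMZV

/-!
# A symmetry of multizeta values of depth two

Every argument of the multizeta values in question has the form `q ^ k - ∑ q ^ l` with fewer than `q`
terms (in the first place) or `∑ (q ^ k - q ^ l)` with at most `q` terms (in the second place). The
power sums `S_d` and `S_{<d}` at such arguments split into products over the exponents `l`, and the
factors of `S_d` and of `S_{<d}` that belong to the same `l` are proportional, with the ratio
`[k - l] ^ q ^ l` up to a factor that depends on `d` and `k` only. So exponents may be moved from one
argument to the other in every term of the series, at the cost of a constant quotient of brackets.

The product formulas come from the Carlitz polynomial `E_d(x) = ∑ β i * x ^ q ^ i`, which vanishes at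
the polynomials of degree less than `d` and is `1` at the monic ones of degree `d`
(`eval_carlitzPoly_algebraMap`). Dividing these relations by `a ^ M` and summing over `a` yields

* `∑ β i * S_d(M - q ^ i) = S_d(M)` (`sum_carlitzCoeff_mul_powerSum`),
* `∑ β i * S_{<d}(M - q ^ i) = 0` for `M ≡ 1` modulo `q - 1` (`sum_carlitzCoeff_mul_lowerPowerSum`),

where the sums are over the `i` with `q ^ i < M`, respectively `q ^ i ≤ M`: the further terms are sums
of nonnegative powers of the `a`, of exponent less than `q ^ d - 1`, which vanish when `M ≥ 2`, by
Lagrange interpolation at the zeros of `E_d` and `E_d - 1` (`leadingCoeff_mul_sum_eval`): these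
polynomials have constant derivative. Together with `S(q * m) = S(m) ^ q` the recursions imply the product
formulas by induction on `k` and the number of exponents `l = 0`
(`map_pow_sub_sum_mul_pow`, `map_sum_pow_sub_pow_eq_prod`).

The proportionality (`bracket_pow_mul_powerSum`) follows by comparing the two recursions for
`M = q ^ k` with a third one, `∑ β i * t ^ q ^ i * S_{<d}(q ^ k - q ^ i) = S_{d - 1}(q ^ k)`, which
expresses the values `E_d(t * a)` for monic `a` of degree less than `d`. Its right-hand side is
matched with `S_d(q ^ k)` through `S_d(1) = β 0 = ± 1 / ([1] ⋯ [d])` (`powerSum_one`).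
-/

namespace CarlitzMZV

open Polynomial

noncomputable section

/-! ### Product formulas for solutions of a `q`-power recursion -/

section Recursions

theorem pow_modEq_one_mod_sub_one {q : ℕ} (hq : 0 < q) (i : ℕ) : q ^ i ≡ 1 [MOD q - 1] := by
  have : q ≡ 1 [MOD q - 1] := ((Nat.modEq_iff_dvd' hq).2 dvd_rfl).symm
  simpa using this.pow i

theorem exists_eq_map_succ_of_zero_notMem {L : Multiset ℕ} (h0 : 0 ∉ L) :
    ∃ L' : Multiset ℕ, L = L'.map Nat.succ := by
  refine ⟨L.map Nat.pred, ?_⟩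
  rw [Multiset.map_map]
  conv_lhs => rw [← Multiset.map_id L]
  refine Multiset.map_congr rfl fun l hl => ?_
  have : l ≠ 0 := fun h => h0 (h ▸ hl)
  simp only [id, Function.comp, Nat.succ_eq_add_one, Nat.pred_eq_sub_one]
  omega

variable {K : Type*} [Field K] {q : ℕ} {β : ℕ → K}

/-- A function on `ℕ` that commutes with `q`-th powers and satisfies the homogeneous recursion
`∑ β i * G (M - q ^ i) = 0` is multiplicative on sums of at most `q` numbers `q ^ k - q ^ l`. -/
theorem map_sum_pow_sub_pow_eq_prod (hq : 1 < q) (hβ : β 0 ≠ 0) {G : ℕ → K} (hG : G 0 = 1)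
    (hfrob : ∀ m, G (q * m) = G m ^ q)
    (hrec : ∀ M n, 2 ≤ M → M ≡ 1 [MOD q - 1] → (∀ i < n, q ^ i ≤ M) → M < q ^ n →
      ∑ i ∈ Finset.range n, β i * G (M - q ^ i) = 0)
    (k : ℕ) (L : Multiset ℕ) (hL : L.card ≤ q) (hk : ∀ l ∈ L, l ≤ k) :
    G (L.map fun l => q ^ k - q ^ l).sum = (L.map fun l => G (q ^ k - q ^ l)).prod := by
  induction k generalizing L with
  | zero =>
    have h (l : ℕ) (hl : l ∈ L) : l = 0 := Nat.le_zero.1 (hk l hl)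
    rw [Multiset.map_congr (g := fun _ => 0) rfl fun l hl => by rw [h l hl, Nat.sub_self],
      Multiset.map_congr (g := fun _ => (1 : K)) rfl fun l hl => by rw [h l hl, Nat.sub_self, hG]]
    simp [hG]
  | succ k ih =>
    -- Solved for its term `i = 0`, the recursion replaces one exponent `0` by the exponents `i ≥ 1`.
    induction hc : L.count 0 using Nat.strong_induction_on generalizing L with
    | _ c ihc =>
    by_cases h0 : 0 ∈ L
    · obtain ⟨L', rfl⟩ := Multiset.exists_cons_of_mem h0
      have hk' : ∀ l ∈ L', l ≤ k + 1 := fun l hl => hk l (Multiset.mem_cons_of_mem hl)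
      have hL' : L'.card + 1 ≤ q := by simpa using hL
      set S := (L'.map fun l => q ^ (k + 1) - q ^ l).sum with hS
      set P := (L'.map fun l => G (q ^ (k + 1) - q ^ l)).prod with hP
      have hpow (i : ℕ) (hi : i ≤ k + 1) : q ^ i ≤ q ^ (k + 1) :=
        Nat.pow_le_pow_right (by omega) hi
      have hq1 : 2 ≤ q ^ (k + 1) := by
        calc 2 ≤ q := hq
          _ = q ^ 1 := (pow_one q).symm
          _ ≤ _ := Nat.pow_le_pow_right (by omega) (by omega)
      have hmod (i : ℕ) : q ^ i ≡ 1 [MOD q - 1] := pow_modEq_one_mod_sub_one hq.le i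
      have hSmod : S ≡ 0 [MOD q - 1] := by
        refine (Nat.modEq_zero_iff_dvd).2 (Multiset.dvd_sum fun x hx => ?_)
        obtain ⟨l, hl, rfl⟩ := Multiset.mem_map.1 hx
        exact (Nat.modEq_iff_dvd' (hpow l (hk' l hl))).1 ((hmod l).trans (hmod _).symm)
      have hSle : S ≤ (q - 1) * (q ^ (k + 1) - 1) := by
        refine (Multiset.sum_le_card_nsmul _ (q ^ (k + 1) - 1) fun x hx => ?_).trans ?_
        · obtain ⟨l, hl, rfl⟩ := Multiset.mem_map.1 hx
          have := Nat.one_le_pow l q (by omega)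
          omega
        · rw [Multiset.card_map, smul_eq_mul]
          exact Nat.mul_le_mul_right _ (by omega)
      have hlt : S + q ^ (k + 1) < q ^ (k + 1 + 1) := by
        obtain ⟨r, rfl⟩ : ∃ r, q = r + 1 := ⟨q - 1, by omega⟩
        obtain ⟨w, hw⟩ : ∃ w, (r + 1) ^ (k + 1) = w + 1 := ⟨(r + 1) ^ (k + 1) - 1, by omega⟩
        rw [pow_succ _ (k + 1)]
        simp only [hw, Nat.add_sub_cancel] at hSle ⊢
        nlinarith
      have hA := hrec (S + q ^ (k + 1)) (k + 1 + 1) (by omega)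
        (by simpa using hSmod.add (hmod (k + 1)))
        (fun i hi => (hpow i (by omega)).trans (by omega)) hlt
      have hB := hrec (q ^ (k + 1)) (k + 1 + 1) hq1 (hmod _) (fun i hi => hpow i (by omega))
        (by omega)
      rw [Finset.sum_range_succ'] at hA hB
      have hterm : ∑ i ∈ Finset.range (k + 1), β (i + 1) * G (S + q ^ (k + 1) - q ^ (i + 1)) =
          (∑ i ∈ Finset.range (k + 1), β (i + 1) * G (q ^ (k + 1) - q ^ (i + 1))) * P := by
        rw [Finset.sum_mul]
        refine Finset.sum_congr rfl fun i hi => ?_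
        have hi' : i + 1 ≤ k + 1 := by simpa using Finset.mem_range.1 hi
        have := ihc (L'.count 0) (by rw [← hc, Multiset.count_cons_self]; omega)
          ((i + 1) ::ₘ L') (by simpa using hL')
          (Multiset.forall_mem_cons.2 ⟨hi', hk'⟩) (by simp)
        rw [Multiset.map_cons, Multiset.sum_cons, Multiset.map_cons, Multiset.prod_cons,
          ← hS, ← hP] at this
        rw [mul_assoc, ← this]
        congr 2
        have := hpow _ hi'
        omega
      rw [Multiset.map_cons, Multiset.sum_cons, Multiset.map_cons, Multiset.prod_cons, ← hS, ← hP]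
      have hSe : q ^ (k + 1) - q ^ 0 + S = S + q ^ (k + 1) - q ^ 0 := by
        have := hpow 0 (by omega)
        omega
      rw [hSe]
      refine mul_left_cancel₀ hβ ?_
      rw [hterm] at hA
      linear_combination hA - P * hB
    · -- Every exponent is positive, and the claim is the `q`-th power of the one for `k`.
      obtain ⟨L', rfl⟩ := exists_eq_map_succ_of_zero_notMem h0
      have := ih L' (by simpa using hL) (by simpa using hk)
      have he (l : ℕ) : q ^ (k + 1) - q ^ (l + 1) = q * (q ^ k - q ^ l) := by
        rw [Nat.mul_sub, ← pow_succ', ← pow_succ']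
      simp only [Multiset.map_map, Function.comp_def, Nat.succ_eq_add_one, he, hfrob,
        Multiset.sum_map_mul_left, Multiset.prod_map_pow, this]

/-- For a function that commutes with `q`-th powers and satisfies the recursion
`∑ β i * H (M - q ^ i) = H M`, the normalized value `H (q ^ k - ∑ q ^ l) / H (q ^ k)`, the sum having
fewer than `q` terms, is the product of the values `H (q ^ k - q ^ l) / H (q ^ k)`. -/
theorem map_pow_sub_sum_mul_pow (hq : 1 < q) (hβ : β 0 ≠ 0) {H : ℕ → K}
    (hfrob : ∀ m, H (q * m) = H m ^ q)
    (hrec : ∀ M n, 2 ≤ M → (∀ i < n, q ^ i < M) → M ≤ q ^ n →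
      ∑ i ∈ Finset.range n, β i * H (M - q ^ i) = H M)
    (k : ℕ) (L : Multiset ℕ) (hL : L.card < q) (hk : ∀ l ∈ L, l < k) :
    H (q ^ k - (L.map fun l => q ^ l).sum) * H (q ^ k) ^ L.card =
      H (q ^ k) * (L.map fun l => H (q ^ k - q ^ l)).prod := by
  induction k generalizing L with
  | zero =>
    obtain rfl : L = 0 := Multiset.eq_zero_of_forall_notMem fun l hl => by simpa using hk l hl
    simp
  | succ k ih =>
    induction hc : L.count 0 using Nat.strong_induction_on generalizing L with
    | _ c ihc =>
    by_cases h0 : 0 ∈ L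
    · obtain ⟨L', rfl⟩ := Multiset.exists_cons_of_mem h0
      have hk' : ∀ l ∈ L', l < k + 1 := fun l hl => hk l (Multiset.mem_cons_of_mem hl)
      have hL' : L'.card + 1 < q := by simpa using hL
      set S := (L'.map fun l => q ^ l).sum with hS
      set P := (L'.map fun l => H (q ^ (k + 1) - q ^ l)).prod with hP
      set h := H (q ^ (k + 1)) with hh
      have hpow (i : ℕ) (hi : i ≤ k) : q ^ i ≤ q ^ k :=
        Nat.pow_le_pow_right (by omega) hi
      have hqk : 1 ≤ q ^ k := Nat.one_le_pow _ _ (by omega)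
      have hSle : S + 2 * q ^ k ≤ q ^ (k + 1) := by
        have h1 : S ≤ L'.card * q ^ k := by
          refine (Multiset.sum_le_card_nsmul _ (q ^ k) fun x hx => ?_).trans ?_
          · obtain ⟨l, hl, rfl⟩ := Multiset.mem_map.1 hx
            exact hpow l (Nat.lt_succ_iff.1 (hk' l hl))
          · simp
        calc S + 2 * q ^ k ≤ (L'.card + 2) * q ^ k := by rw [add_mul]; omega
          _ ≤ q * q ^ k := Nat.mul_le_mul_right _ (by omega)
          _ = _ := (pow_succ' q k).symm
      have hA := hrec (q ^ (k + 1) - S) (k + 1) (by omega)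
        (fun i hi => by have := hpow i (by omega); omega) (by omega)
      have hB := hrec (q ^ (k + 1)) (k + 1) (by omega)
        (fun i hi => by have := hpow i (by omega); omega) le_rfl
      rw [Finset.sum_range_succ'] at hA hB
      have hterm : (∑ i ∈ Finset.range k, β (i + 1) * H (q ^ (k + 1) - S - q ^ (i + 1))) *
            h ^ (L'.card + 1) =
          (∑ i ∈ Finset.range k, β (i + 1) * H (q ^ (k + 1) - q ^ (i + 1))) * (h * P) := by
        rw [Finset.sum_mul, Finset.sum_mul]
        refine Finset.sum_congr rfl fun i hi => ?_
        have hi' : i < k := by simpa using Finset.mem_range.1 hi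
        have := ihc (L'.count 0) (by rw [← hc, Multiset.count_cons_self]; omega)
          ((i + 1) ::ₘ L') (by simpa using hL')
          (Multiset.forall_mem_cons.2 ⟨by omega, hk'⟩) (by simp)
        rw [Multiset.map_cons, Multiset.sum_cons, Multiset.map_cons, Multiset.prod_cons,
          Multiset.card_cons, ← hS, ← hP, ← Nat.sub_sub, Nat.sub_right_comm] at this
        rw [mul_assoc, this]
        ring
      have hS' : H (q ^ (k + 1) - S) * h ^ L'.card = h * P :=
        ihc (L'.count 0) (by rw [← hc, Multiset.count_cons_self]; omega) L' (by omega) hk' rfl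
      rw [Multiset.map_cons, Multiset.sum_cons, Multiset.map_cons, Multiset.prod_cons,
        Multiset.card_cons, ← hS, ← hP, ← Nat.sub_sub, Nat.sub_right_comm]
      refine mul_left_cancel₀ hβ ?_
      linear_combination h ^ (L'.card + 1) * hA - hterm + h * hS' - h * P * hB
    · -- Every exponent is positive, and the claim is the `q`-th power of the one for `k`.
      obtain ⟨L', rfl⟩ := exists_eq_map_succ_of_zero_notMem h0
      have := ih L' (by simpa using hL) (by simpa using hk)
      simp only [Multiset.map_map, Function.comp_def, Nat.succ_eq_add_one, pow_succ' q,
        Multiset.sum_map_mul_left, ← Nat.mul_sub, hfrob, Multiset.prod_map_pow,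
        Multiset.card_map]
      rw [← mul_pow, ← this, mul_pow, pow_right_comm]

/-- Up to a factor that does not depend on `l`, the values of `H` and `G` at `q ^ k - q ^ l` differ by
`t ^ q ^ k - t ^ q ^ l`. For `l = 0` this holds because the defect
`c ^ q ^ k * H (q ^ k - q ^ l) - (t ^ q ^ k - t ^ q ^ l) * G (q ^ k - q ^ l)`, weighted by `β l` and
summed over `l < k`, vanishes, and all its terms with `l ≥ 1` are `q`-th powers of earlier defects. -/
theorem map_pow_sub_pow_mul (hβ : β 0 ≠ 0) {φ : K →+* K} (hφ : ∀ x, φ x = x ^ q)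
    {G H : ℕ → K} (hGfrob : ∀ m, G (q * m) = G m ^ q) (hHfrob : ∀ m, H (q * m) = H m ^ q)
    {t c : K}
    (hH : ∀ k, 1 ≤ k → ∑ i ∈ Finset.range k, β i * H (q ^ k - q ^ i) = H (q ^ k))
    (hG : ∀ k, 1 ≤ k → ∑ i ∈ Finset.range (k + 1), β i * G (q ^ k - q ^ i) = 0)
    (hGt : ∀ k, 1 ≤ k → ∑ i ∈ Finset.range (k + 1), β i * t ^ q ^ i * G (q ^ k - q ^ i) =
      -(c ^ q ^ k * H (q ^ k)))
    (k l : ℕ) (hl : l < k) :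
    c ^ q ^ k * H (q ^ k - q ^ l) = (t ^ q ^ k - t ^ q ^ l) * G (q ^ k - q ^ l) := by
  induction k generalizing l with
  | zero => omega
  | succ k ih =>
    have hs (l : ℕ) (hl : l < k) : c ^ q ^ (k + 1) * H (q ^ (k + 1) - q ^ (l + 1)) =
        (t ^ q ^ (k + 1) - t ^ q ^ (l + 1)) * G (q ^ (k + 1) - q ^ (l + 1)) := by
      have := congrArg φ (ih l hl)
      rw [map_mul, map_mul, map_sub] at this
      simp only [hφ, ← pow_mul, ← pow_succ] at this
      rwa [pow_succ' q k, pow_succ' q l, ← Nat.mul_sub, hGfrob, hHfrob, ← pow_succ', ← pow_succ']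
    cases l with
    | succ l => exact hs l (by omega)
    | zero =>
      have h1 := hH (k + 1) (by omega)
      have h2 := hG (k + 1) (by omega)
      have h3 := hGt (k + 1) (by omega)
      rw [Finset.sum_range_succ, Finset.sum_range_succ'] at h2 h3
      rw [Finset.sum_range_succ'] at h1
      have h4 : ∑ i ∈ Finset.range k, β (i + 1) * t ^ q ^ (i + 1) *
            G (q ^ (k + 1) - q ^ (i + 1)) =
          t ^ q ^ (k + 1) * (∑ i ∈ Finset.range k, β (i + 1) * G (q ^ (k + 1) - q ^ (i + 1))) -
          c ^ q ^ (k + 1) * (∑ i ∈ Finset.range k, β (i + 1) * H (q ^ (k + 1) - q ^ (i + 1))) := by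
        rw [Finset.mul_sum, Finset.mul_sum, ← Finset.sum_sub_distrib]
        refine Finset.sum_congr rfl fun i hi => ?_
        linear_combination β (i + 1) * (hs i (Finset.mem_range.1 hi))
      refine mul_left_cancel₀ hβ ?_
      linear_combination c ^ q ^ (k + 1) * h1 - t ^ q ^ (k + 1) * h2 + h3 - h4

end Recursions

/-! ### Power sums over the zeros of a polynomial with constant derivative -/

/-- If the derivative of `Q` is a constant `c`, Lagrange interpolation at the zeros of `Q` says that
the sum of the values of `f` at these zeros only sees the top coefficient of `f`. -/
theorem leadingCoeff_mul_sum_eval {K ι : Type*} [Field K] {s : Finset ι} {v : ι → K}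
    (hv : Set.InjOn v s) {Q : K[X]} (hQ : Q.natDegree = s.card) (hQ0 : Q ≠ 0)
    (hQv : ∀ i ∈ s, Q.eval (v i) = 0) {c : K} (hc : derivative Q = C c) {f : K[X]}
    (hf : f.degree < s.card) :
    Q.leadingCoeff * ∑ i ∈ s, f.eval (v i) = c * f.coeff (s.card - 1) := by
  classical
  have hb : Q.leadingCoeff ≠ 0 := leadingCoeff_ne_zero.2 hQ0
  have hdeg : (C Q.leadingCoeff * Lagrange.nodal s v).degree = s.card := by
    rw [degree_C_mul hb, Lagrange.degree_nodal]
  have hQd : Q.degree = s.card := by rw [degree_eq_natDegree hQ0, hQ]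
  have hQn : Q = C Q.leadingCoeff * Lagrange.nodal s v := by
    refine eq_of_degree_sub_lt_of_eval_index_eq s hv ?_ fun i hi => ?_
    · rw [← hQd]
      refine degree_sub_lt_left (hQd.trans hdeg.symm) hQ0 ?_
      rw [leadingCoeff_mul, leadingCoeff_C, Lagrange.nodal_monic.leadingCoeff, mul_one]
    · rw [hQv i hi, eval_mul, Lagrange.eval_nodal_at_node hi, mul_zero]
  rw [Lagrange.coeff_eq_sum hv hf, Finset.mul_sum, Finset.mul_sum]
  refine Finset.sum_congr rfl fun i hi => ?_
  have h1 : c = Q.leadingCoeff * ∏ j ∈ s.erase i, (v i - v j) := by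
    have := congrArg (fun p => (derivative p).eval (v i)) hQn
    rwa [hc, eval_C, derivative_C_mul, eval_C_mul,
      Lagrange.eval_nodal_derivative_eval_node_eq hi, Lagrange.eval_nodal] at this
  have h2 : ∏ j ∈ s.erase i, (v i - v j) ≠ 0 := Finset.prod_ne_zero_iff.2 fun j hj => by
    rw [Finset.mem_erase] at hj
    exact sub_ne_zero.2 fun h => hj.1 (hv hj.2 hi h.symm)
  rw [h1]
  field_simp

/-! ### Summation of a relation between powers -/

/-- Dividing a relation `∑ c i * x ^ q ^ i = g x` by `x ^ M` and summing it over `x = a ∈ Z` gives a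
recursion between the sums of negative powers of the `a ∈ Z`, provided that the sums of nonnegative
powers that occur vanish. -/
theorem sum_mul_sum_one_div_pow {F : Type*} [Field F] {d M n : ℕ} {c : ℕ → RatFunc F}
    (hc : ∀ i, d < i → c i = 0) {Z : Finset F[X]} (hZ : ∀ a ∈ Z, a ≠ 0)
    (hle : ∀ i < n, Nat.card F ^ i ≤ M)
    (hvan : ∀ i, n ≤ i → i ≤ d → M ≤ Nat.card F ^ i ∧
      ∑ a ∈ Z, algebraMap F[X] (RatFunc F) a ^ (Nat.card F ^ i - M) = 0) :
    ∑ i ∈ Finset.range n,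
        c i * ∑ a ∈ Z, 1 / algebraMap F[X] (RatFunc F) a ^ (M - Nat.card F ^ i) =
      ∑ a ∈ Z, (∑ i ∈ Finset.range (d + 1),
        c i * algebraMap F[X] (RatFunc F) a ^ Nat.card F ^ i) /
          algebraMap F[X] (RatFunc F) a ^ M := by
  have hZ' (a : F[X]) (ha : a ∈ Z) : algebraMap F[X] (RatFunc F) a ≠ 0 := by
    simpa using hZ a ha
  have h1 : ∀ a ∈ Z, (∑ i ∈ Finset.range (d + 1),
        c i * algebraMap F[X] (RatFunc F) a ^ Nat.card F ^ i) /
          algebraMap F[X] (RatFunc F) a ^ M =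
      ∑ i ∈ Finset.range (n + (d + 1)), c i * (algebraMap F[X] (RatFunc F) a ^ Nat.card F ^ i /
          algebraMap F[X] (RatFunc F) a ^ M) := by
    intro a _
    rw [add_comm n, Finset.sum_range_add _ (d + 1), Finset.sum_eq_zero (s := Finset.range n)
      fun i _ => by rw [hc _ (by omega), zero_mul], add_zero, Finset.sum_div]
    simp only [mul_div_assoc]
  rw [Finset.sum_congr rfl h1, Finset.sum_comm, Finset.sum_range_add, add_eq_left.2]
  · refine Finset.sum_congr rfl fun i hi => ?_
    rw [Finset.mul_sum]
    refine Finset.sum_congr rfl fun a ha => ?_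
    have h2 := hle i (Finset.mem_range.1 hi)
    conv_rhs => rw [← Nat.sub_add_cancel h2, pow_add]
    have := hZ' a ha
    field_simp
  · refine Finset.sum_eq_zero fun i _ => ?_
    rcases lt_or_ge d (n + i) with h | h
    · exact Finset.sum_eq_zero fun a _ => by rw [hc _ h, zero_mul]
    · obtain ⟨h2, h3⟩ := hvan (n + i) (by omega) h
      rw [← Finset.mul_sum, Finset.sum_congr rfl fun a ha => ?_, h3, mul_zero]
      rw [div_eq_iff (pow_ne_zero _ (hZ' a ha)), ← pow_add, Nat.sub_add_cancel h2]

/-! ### The Carlitz polynomials -/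

variable (F : Type*) [Field F]

/-- The coefficient of `x ^ q ^ i` in the Carlitz polynomial `E_d`; see `carlitzPoly`. -/
def carlitzCoeff : ℕ → ℕ → RatFunc F
  | 0, i => if i = 0 then 1 else 0
  | d + 1, 0 => -(bracket F (d + 1))⁻¹ * carlitzCoeff d 0
  | d + 1, i + 1 =>
      (bracket F (d + 1))⁻¹ * (carlitzCoeff d i ^ Nat.card F - carlitzCoeff d (i + 1))

/-- The Carlitz polynomial `E_d(x) = e_d(x) / D_d`, where `e_d` is the product of `x - a` over the
polynomials `a` of degree less than `d` and `D_d` is the product of the monic polynomials of degree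
`d`. It is defined through its coefficients, by the recursion `[d + 1] E_{d + 1} = E_d ^ q - E_d`
with `E_0 = x`. -/
def carlitzPoly (d : ℕ) : (RatFunc F)[X] :=
  ∑ i ∈ Finset.range (d + 1), C (carlitzCoeff F d i) * X ^ Nat.card F ^ i

theorem eval_carlitzPoly (d : ℕ) (x : RatFunc F) : (carlitzPoly F d).eval x =
    ∑ i ∈ Finset.range (d + 1), carlitzCoeff F d i * x ^ Nat.card F ^ i := by
  simp [carlitzPoly, eval_finsetSum]

theorem eval_carlitzPoly_zero_left (x : RatFunc F) : (carlitzPoly F 0).eval x = x := by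
  simp [eval_carlitzPoly, carlitzCoeff]

variable [Finite F]

theorem one_lt_natCard_field : 1 < Nat.card F := Finite.one_lt_card

theorem exists_ringHom_pow_card :
    ∃ φ : RatFunc F →+* RatFunc F, ∀ x, φ x = x ^ Nat.card F := by
  have := Fintype.ofFinite F
  exact ⟨(FiniteField.frobeniusAlgHom F (RatFunc F)).toRingHom, fun x => by
    rw [Nat.card_eq_fintype_card]; rfl⟩

theorem natCard_cast_ratFunc : (Nat.card F : RatFunc F) = 0 := by
  have := Fintype.ofFinite F
  rw [Nat.card_eq_fintype_card]
  rw [← map_natCast (algebraMap F (RatFunc F)), FiniteField.cast_card_eq_zero, map_zero]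

variable {F}

theorem add_pow_card_pow (x y : RatFunc F) (i : ℕ) :
    (x + y) ^ Nat.card F ^ i = x ^ Nat.card F ^ i + y ^ Nat.card F ^ i := by
  obtain ⟨φ, hφ⟩ := exists_ringHom_pow_card F
  induction i with
  | zero => simp
  | succ i ih =>
    have := congrArg φ ih
    rwa [map_add, hφ, hφ, hφ, ← pow_mul, ← pow_mul, ← pow_mul, ← pow_succ] at this

theorem neg_pow_card_pow (x : RatFunc F) (i : ℕ) :
    (-x) ^ Nat.card F ^ i = -x ^ Nat.card F ^ i := by
  have := add_pow_card_pow x (-x) i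
  rw [add_neg_cancel, zero_pow (pow_ne_zero _ Nat.card_pos.ne')] at this
  linear_combination -this

theorem sub_pow_card_pow (x y : RatFunc F) (i : ℕ) :
    (x - y) ^ Nat.card F ^ i = x ^ Nat.card F ^ i - y ^ Nat.card F ^ i := by
  rw [sub_eq_add_neg, add_pow_card_pow, neg_pow_card_pow, sub_eq_add_neg]

variable (F)

theorem bracket_ne_zero {n : ℕ} (hn : n ≠ 0) : bracket F n ≠ 0 := by
  have := Fintype.ofFinite F
  have h := FiniteField.X_pow_card_pow_sub_X_ne_zero F hn (Finite.one_lt_card (α := F))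
  have h2 : bracket F n = algebraMap F[X] (RatFunc F) (X ^ Nat.card F ^ n - X) := by
    simp [bracket]
  rw [h2]
  exact (map_ne_zero_iff _ (IsFractionRing.injective F[X] (RatFunc F))).2 h

theorem bracket_pow_card_pow (n i : ℕ) : bracket F n ^ Nat.card F ^ i =
    RatFunc.X ^ Nat.card F ^ (n + i) - RatFunc.X ^ Nat.card F ^ i := by
  rw [bracket, sub_pow_card_pow, ← pow_mul, ← pow_add]

theorem bracket_mul_carlitzCoeff_zero (d : ℕ) :
    bracket F (d + 1) * carlitzCoeff F (d + 1) 0 = -carlitzCoeff F d 0 := by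
  have := bracket_ne_zero F d.succ_ne_zero
  rw [carlitzCoeff]
  field_simp

theorem bracket_mul_carlitzCoeff_succ (d i : ℕ) :
    bracket F (d + 1) * carlitzCoeff F (d + 1) (i + 1) =
      carlitzCoeff F d i ^ Nat.card F - carlitzCoeff F d (i + 1) := by
  have := bracket_ne_zero F d.succ_ne_zero
  rw [carlitzCoeff]
  field_simp

theorem carlitzCoeff_eq_zero {d i : ℕ} (h : d < i) : carlitzCoeff F d i = 0 := by
  induction d generalizing i with
  | zero => rw [carlitzCoeff, if_neg (by omega)]
  | succ d ih =>
    obtain ⟨i, rfl⟩ : ∃ j, i = j + 1 := ⟨i - 1, by omega⟩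
    rw [carlitzCoeff, ih (by omega), ih (by omega), zero_pow Nat.card_pos.ne', sub_zero, mul_zero]

theorem carlitzCoeff_self_ne_zero (d : ℕ) : carlitzCoeff F d d ≠ 0 := by
  induction d with
  | zero => simp [carlitzCoeff]
  | succ d ih =>
    rw [carlitzCoeff, carlitzCoeff_eq_zero F d.lt_succ_self, sub_zero]
    exact mul_ne_zero (inv_ne_zero (bracket_ne_zero F d.succ_ne_zero)) (pow_ne_zero _ ih)

theorem carlitzCoeff_zero_ne_zero (d : ℕ) : carlitzCoeff F d 0 ≠ 0 := by
  induction d with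
  | zero => simp [carlitzCoeff]
  | succ d ih =>
    rw [carlitzCoeff]
    exact mul_ne_zero (neg_ne_zero.2 (inv_ne_zero (bracket_ne_zero F d.succ_ne_zero))) ih

theorem bracket_mul_eval_carlitzPoly_succ (d : ℕ) (x : RatFunc F) :
    bracket F (d + 1) * (carlitzPoly F (d + 1)).eval x =
      (carlitzPoly F d).eval x ^ Nat.card F - (carlitzPoly F d).eval x := by
  obtain ⟨φ, hφ⟩ := exists_ringHom_pow_card F
  have h1 : (carlitzPoly F d).eval x = ∑ i ∈ Finset.range (d + 1),
      carlitzCoeff F d (i + 1) * x ^ Nat.card F ^ (i + 1) + carlitzCoeff F d 0 * x := by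
    rw [eval_carlitzPoly, Finset.sum_range_succ', Finset.sum_range_succ _ d,
      carlitzCoeff_eq_zero F d.lt_succ_self]
    simp
  have h2 : (carlitzPoly F d).eval x ^ Nat.card F = ∑ i ∈ Finset.range (d + 1),
      carlitzCoeff F d i ^ Nat.card F * x ^ Nat.card F ^ (i + 1) := by
    rw [← hφ, eval_carlitzPoly, map_sum]
    refine Finset.sum_congr rfl fun i _ => ?_
    rw [map_mul, hφ, hφ, ← pow_mul, ← pow_succ]
  rw [h2, h1, eval_carlitzPoly, Finset.sum_range_succ', mul_add, Finset.mul_sum, ← mul_assoc,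
    bracket_mul_carlitzCoeff_zero, ← sub_sub, ← Finset.sum_sub_distrib, pow_zero, pow_one,
    neg_mul, sub_eq_add_neg]
  congr 1
  refine Finset.sum_congr rfl fun i _ => ?_
  rw [← mul_assoc, bracket_mul_carlitzCoeff_succ, sub_mul]

theorem eval_carlitzPoly_X_mul (d : ℕ) (x : RatFunc F) :
    (carlitzPoly F (d + 1)).eval (RatFunc.X * x) =
      RatFunc.X * (carlitzPoly F (d + 1)).eval x + (carlitzPoly F d).eval x ^ Nat.card F := by
  induction d with
  | zero =>
    have hb := bracket_ne_zero F one_ne_zero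
    have h1 := bracket_mul_eval_carlitzPoly_succ F 0 x
    have h2 := bracket_mul_eval_carlitzPoly_succ F 0 (RatFunc.X * x)
    rw [eval_carlitzPoly_zero_left] at h1 h2 ⊢
    rw [zero_add] at *
    refine mul_left_cancel₀ hb ?_
    have h3 : bracket F 1 = RatFunc.X ^ Nat.card F - RatFunc.X := by simp [bracket]
    rw [mul_pow] at h2
    linear_combination h2 - RatFunc.X * h1 - x ^ Nat.card F * h3
  | succ d ih =>
    have hb := bracket_ne_zero F (d + 1).succ_ne_zero
    have h1 := bracket_mul_eval_carlitzPoly_succ F (d + 1) x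
    have h2 := bracket_mul_eval_carlitzPoly_succ F (d + 1) (RatFunc.X * x)
    have h4 := congrArg (· ^ Nat.card F ^ 1) (bracket_mul_eval_carlitzPoly_succ F d x)
    simp only [mul_pow, bracket_pow_card_pow, sub_pow_card_pow] at h4
    have h5 : bracket F (d + 1 + 1) = RatFunc.X ^ Nat.card F ^ (d + 1 + 1) - RatFunc.X := rfl
    have h6 := add_pow_card_pow (RatFunc.X * (carlitzPoly F (d + 1)).eval x)
      ((carlitzPoly F d).eval x ^ Nat.card F) 1
    simp only [pow_one, mul_pow] at h4 h6
    rw [ih, h6] at h2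
    refine mul_left_cancel₀ hb ?_
    linear_combination h2 - RatFunc.X * h1 - h4 -
      (carlitzPoly F (d + 1)).eval x ^ Nat.card F * h5

theorem eval_carlitzPoly_add (d : ℕ) (x y : RatFunc F) : (carlitzPoly F d).eval (x + y) =
    (carlitzPoly F d).eval x + (carlitzPoly F d).eval y := by
  simp only [eval_carlitzPoly, add_pow_card_pow, mul_add, Finset.sum_add_distrib]

/-- The interpolation property of `E_d`: it vanishes at the polynomials of degree less than `d`, and
is `1` at the monic polynomials of degree `d`. -/
theorem eval_carlitzPoly_algebraMap {d : ℕ} {a : F[X]} (ha : a.natDegree ≤ d) :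
    (carlitzPoly F d).eval (algebraMap F[X] (RatFunc F) a) =
      algebraMap F (RatFunc F) (a.coeff d) := by
  have hpow (c : F) : algebraMap F (RatFunc F) c ^ Nat.card F = algebraMap F (RatFunc F) c := by
    have := Fintype.ofFinite F
    rw [← map_pow, Nat.card_eq_fintype_card, FiniteField.pow_card]
  induction d generalizing a with
  | zero =>
    rw [eval_carlitzPoly_zero_left]
    conv_lhs => rw [eq_C_of_natDegree_le_zero ha]
    simp
  | succ d ih =>
    have hlow {b : F[X]} (hb : b.natDegree ≤ d) :
        (carlitzPoly F (d + 1)).eval (algebraMap F[X] (RatFunc F) b) = 0 := by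
      refine mul_left_cancel₀ (bracket_ne_zero F d.succ_ne_zero) ?_
      rw [bracket_mul_eval_carlitzPoly_succ, ih hb, hpow, sub_self, mul_zero]
    have hb : a.divX.natDegree ≤ d := by
      rw [natDegree_divX_eq_natDegree_tsub_one]; omega
    conv_lhs => rw [← divX_mul_X_add a]
    rw [map_add, eval_carlitzPoly_add, hlow (b := C (a.coeff 0)) (by simp), add_zero, map_mul,
      RatFunc.algebraMap_X, mul_comm, eval_carlitzPoly_X_mul, hlow hb, ih hb, hpow, coeff_divX,
      mul_zero, zero_add]

theorem coeff_carlitzPoly_top (d : ℕ) :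
    (carlitzPoly F d).coeff (Nat.card F ^ d) = carlitzCoeff F d d := by
  rw [carlitzPoly, finsetSum_coeff, Finset.sum_eq_single d]
  · simp
  · intro i _ hi
    rw [coeff_C_mul_X_pow,
      if_neg fun h => hi (Nat.pow_right_injective (one_lt_natCard_field F) h).symm]
  · simp

theorem natDegree_carlitzPoly (d : ℕ) : (carlitzPoly F d).natDegree = Nat.card F ^ d := by
  refine le_antisymm (natDegree_sum_le_of_forall_le _ _ fun i hi => ?_)
    (le_natDegree_of_ne_zero ?_)
  · refine (natDegree_C_mul_X_pow_le _ _).trans (Nat.pow_le_pow_right Nat.card_pos ?_)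
    simpa [Nat.lt_succ_iff] using hi
  · rw [coeff_carlitzPoly_top]
    exact carlitzCoeff_self_ne_zero F d

theorem leadingCoeff_carlitzPoly (d : ℕ) :
    (carlitzPoly F d).leadingCoeff = carlitzCoeff F d d := by
  rw [leadingCoeff, natDegree_carlitzPoly, coeff_carlitzPoly_top]

theorem derivative_carlitzPoly (d : ℕ) :
    derivative (carlitzPoly F d) = C (carlitzCoeff F d 0) := by
  rw [carlitzPoly, derivative_sum, Finset.sum_range_succ', Finset.sum_eq_zero]
  · simp
  · intro i _
    rw [derivative_C_mul_X_pow, Nat.cast_pow, natCard_cast_ratFunc, zero_pow i.succ_ne_zero,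
      mul_zero, C_0, zero_mul]

/-! ### Sums over polynomials of bounded degree -/

theorem card_monics (d : ℕ) : (monics F d).card = Nat.card F ^ d := by
  rw [monics, ← Set.ncard_eq_toFinset_card _ (finite_monic_natDegree_eq F d), ← Nat.card_coe_set_eq]
  refine (Nat.card_congr ((monicEquivDegreeLT d).trans (degreeLTEquiv F d).toEquiv)).trans ?_
  simp [Nat.card_fun]

theorem finite_degree_lt (d : ℕ) : {a : F[X] | a.degree < d}.Finite := by
  have h : (degreeLT F d : Set F[X]).Finite :=
    have := Finite.of_equiv _ (degreeLTEquiv F d).symm.toEquiv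
    Set.toFinite _
  exact h.subset fun a ha => mem_degreeLT.2 ha

/-- The finite set of the polynomials of degree less than `d`, zero included. -/
def polysLT (d : ℕ) : Finset F[X] := (finite_degree_lt F d).toFinset

theorem mem_polysLT {d : ℕ} {a : F[X]} : a ∈ polysLT F d ↔ a.degree < d := by simp [polysLT]

theorem card_polysLT (d : ℕ) : (polysLT F d).card = Nat.card F ^ d := by
  have h : {a : F[X] | a.degree < d} = degreeLT F d := by
    ext a; exact mem_degreeLT.symm
  rw [polysLT, ← Set.ncard_eq_toFinset_card _ (finite_degree_lt F d), ← Nat.card_coe_set_eq, h]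
  refine (Nat.card_congr (degreeLTEquiv F d).toEquiv).trans ?_
  simp [Nat.card_fun]

theorem carlitzCoeff_mul_sum_polysLT {d : ℕ} {f : (RatFunc F)[X]}
    (hf : f.degree < (Nat.card F ^ d : ℕ)) :
    carlitzCoeff F d d * ∑ a ∈ polysLT F d, f.eval (algebraMap F[X] (RatFunc F) a) =
      carlitzCoeff F d 0 * f.coeff (Nat.card F ^ d - 1) := by
  rw [← leadingCoeff_carlitzPoly, ← card_polysLT]
  refine leadingCoeff_mul_sum_eval (IsFractionRing.injective F[X] (RatFunc F)).injOn ?_ ?_ ?_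
    (derivative_carlitzPoly F d) (by rwa [card_polysLT])
  · rw [natDegree_carlitzPoly, card_polysLT]
  · rw [← leadingCoeff_ne_zero, leadingCoeff_carlitzPoly]
    exact carlitzCoeff_self_ne_zero F d
  · intro a ha
    rw [mem_polysLT] at ha
    rw [eval_carlitzPoly_algebraMap F (natDegree_le_of_degree_le ha.le),
      coeff_eq_zero_of_degree_lt ha, map_zero]

theorem carlitzCoeff_mul_sum_monics {d : ℕ} {f : (RatFunc F)[X]}
    (hf : f.degree < (Nat.card F ^ d : ℕ)) :
    carlitzCoeff F d d * ∑ a ∈ monics F d, f.eval (algebraMap F[X] (RatFunc F) a) =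
      carlitzCoeff F d 0 * f.coeff (Nat.card F ^ d - 1) := by
  have hdeg : (C 1 : (RatFunc F)[X]).degree < (carlitzPoly F d).degree := by
    refine degree_lt_degree ?_
    rw [natDegree_C, natDegree_carlitzPoly]
    exact pow_pos Nat.card_pos d
  rw [← leadingCoeff_carlitzPoly, ← leadingCoeff_sub_of_degree_lt hdeg, ← card_monics]
  refine leadingCoeff_mul_sum_eval (IsFractionRing.injective F[X] (RatFunc F)).injOn ?_ ?_ ?_
    ?_ (by rwa [card_monics])
  · rw [natDegree_sub_C, natDegree_carlitzPoly, card_monics]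
  · rw [← leadingCoeff_ne_zero, leadingCoeff_sub_of_degree_lt hdeg, leadingCoeff_carlitzPoly]
    exact carlitzCoeff_self_ne_zero F d
  · intro a ha
    obtain ⟨h1, h2⟩ := (mem_monics F).1 ha
    rw [eval_sub, eval_carlitzPoly_algebraMap F h2.le, ← h2, coeff_natDegree, h1.leadingCoeff]
    simp
  · rw [derivative_sub, derivative_C, sub_zero, derivative_carlitzPoly]

theorem sum_monics_pow_eq_zero {d j : ℕ} (hj : j + 1 < Nat.card F ^ d) :
    ∑ a ∈ monics F d, algebraMap F[X] (RatFunc F) a ^ j = 0 := by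
  have h := carlitzCoeff_mul_sum_monics F (d := d) (f := X ^ j)
    (by rw [degree_X_pow]; exact_mod_cast (by omega))
  rw [coeff_X_pow, if_neg (by omega), mul_zero] at h
  simpa [carlitzCoeff_self_ne_zero F d] using h

theorem sum_polysLT_pow_eq_zero {d j : ℕ} (hj : j + 1 < Nat.card F ^ d) :
    ∑ a ∈ polysLT F d, algebraMap F[X] (RatFunc F) a ^ j = 0 := by
  have h := carlitzCoeff_mul_sum_polysLT F (d := d) (f := X ^ j)
    (by rw [degree_X_pow]; exact_mod_cast (by omega))
  rw [coeff_X_pow, if_neg (by omega), mul_zero] at h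
  simpa [carlitzCoeff_self_ne_zero F d] using h

/-- On the monic polynomials of degree `d`, where `E_d` takes the value `1`, the function `1 / a`
agrees with the polynomial `E_d(a) / a`, to which the Lagrange formula applies. -/
theorem powerSum_one (d : ℕ) : powerSum F d 1 = carlitzCoeff F d 0 := by
  have hlt {i : ℕ} (hi : i ∈ Finset.range (d + 1)) : Nat.card F ^ i - 1 < Nat.card F ^ d := by
    have h1 := Nat.pow_le_pow_right (Nat.card_pos (α := F)) (Finset.mem_range_succ_iff.1 hi)
    have h2 : 0 < Nat.card F ^ i := pow_pos Nat.card_pos i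
    omega
  set f : (RatFunc F)[X] :=
    ∑ i ∈ Finset.range (d + 1), C (carlitzCoeff F d i) * X ^ (Nat.card F ^ i - 1) with hf
  have hcoeff : f.coeff (Nat.card F ^ d - 1) = carlitzCoeff F d d := by
    rw [hf, finsetSum_coeff, Finset.sum_eq_single d]
    · simp
    · intro i _ hi
      rw [coeff_C_mul_X_pow, if_neg fun h => hi ?_]
      have h1 : 0 < Nat.card F ^ i := pow_pos Nat.card_pos i
      have h2 : 0 < Nat.card F ^ d := pow_pos Nat.card_pos d
      exact Nat.pow_right_injective (one_lt_natCard_field F) (by dsimp only; omega)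
    · simp
  have hdeg : f.degree < (Nat.card F ^ d : ℕ) := by
    refine (degree_sum_le _ _).trans_lt ((Finset.sup_lt_iff (WithBot.bot_lt_coe _)).2 ?_)
    intro i hi
    exact (degree_C_mul_X_pow_le _ _).trans_lt (by exact_mod_cast hlt hi)
  have h := carlitzCoeff_mul_sum_monics F hdeg
  rw [hcoeff, mul_comm] at h
  rw [← mul_right_cancel₀ (carlitzCoeff_self_ne_zero F d) h, powerSum]
  refine Finset.sum_congr rfl fun a ha => ?_
  obtain ⟨h1, h2⟩ := (mem_monics F).1 ha
  have ha0 : algebraMap F[X] (RatFunc F) a ≠ 0 := by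
    simpa using h1.ne_zero
  have h3 := eval_carlitzPoly_algebraMap F h2.le
  rw [← h2, coeff_natDegree, h1.leadingCoeff, map_one, h2] at h3
  rw [pow_one, div_eq_iff ha0, ← h3, eval_carlitzPoly, hf, eval_finsetSum, Finset.sum_mul]
  refine Finset.sum_congr rfl fun i _ => ?_
  have h4 : Nat.card F ^ i - 1 + 1 = Nat.card F ^ i :=
    Nat.sub_add_cancel (pow_pos Nat.card_pos i)
  rw [eval_C_mul, eval_pow, eval_X, mul_assoc, ← pow_succ, h4]

/-! ### Power sums in lower degrees -/

/-- `S_{<d}(k)`: the sum of `1 / a ^ k` over the monic `a` of degree less than `d`. -/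
def lowerPowerSum (d k : ℕ) : RatFunc F := ∑ i ∈ Finset.range d, powerSum F i k

theorem finite_monic_natDegree_lt (d : ℕ) : {a : F[X] | a.Monic ∧ a.natDegree < d}.Finite :=
  (finite_degree_lt F d).subset fun _ ha => (natDegree_lt_iff_degree_lt ha.1.ne_zero).1 ha.2

/-- The finite set of the monic polynomials of degree less than `d`. -/
def lowerMonics (d : ℕ) : Finset F[X] := (finite_monic_natDegree_lt F d).toFinset

theorem mem_lowerMonics {d : ℕ} {a : F[X]} :
    a ∈ lowerMonics F d ↔ a.Monic ∧ a.natDegree < d := by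
  simp [lowerMonics]

theorem sum_lowerMonics (d : ℕ) (f : F[X] → RatFunc F) :
    ∑ a ∈ lowerMonics F d, f a = ∑ i ∈ Finset.range d, ∑ a ∈ monics F i, f a := by
  classical
  rw [← Finset.sum_fiberwise_of_maps_to (s := lowerMonics F d) (t := Finset.range d)
    (g := natDegree) fun a ha => Finset.mem_range.2 ((mem_lowerMonics F).1 ha).2]
  refine Finset.sum_congr rfl fun i hi => Finset.sum_congr ?_ fun _ _ => rfl
  ext a
  rw [Finset.mem_range] at hi
  rw [Finset.mem_filter, mem_lowerMonics, mem_monics]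
  constructor
  · rintro ⟨⟨h1, -⟩, h2⟩; exact ⟨h1, h2⟩
  · rintro ⟨h1, h2⟩; exact ⟨⟨h1, by omega⟩, h2⟩

theorem lowerPowerSum_eq_sum (d k : ℕ) : lowerPowerSum F d k =
    ∑ a ∈ lowerMonics F d, 1 / algebraMap F[X] (RatFunc F) a ^ k := by
  rw [sum_lowerMonics]; rfl

theorem powerSum_card_mul (d k : ℕ) :
    powerSum F d (Nat.card F * k) = powerSum F d k ^ Nat.card F := by
  obtain ⟨φ, hφ⟩ := exists_ringHom_pow_card F
  rw [← hφ, powerSum, powerSum, map_sum]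
  refine Finset.sum_congr rfl fun a _ => ?_
  rw [hφ, div_pow, one_pow, ← pow_mul, mul_comm]

theorem lowerPowerSum_card_mul (d k : ℕ) :
    lowerPowerSum F d (Nat.card F * k) = lowerPowerSum F d k ^ Nat.card F := by
  obtain ⟨φ, hφ⟩ := exists_ringHom_pow_card F
  rw [← hφ, lowerPowerSum, lowerPowerSum, map_sum]
  refine Finset.sum_congr rfl fun a _ => ?_
  rw [hφ, powerSum_card_mul]

theorem powerSum_card_pow (d k : ℕ) :
    powerSum F d (Nat.card F ^ k) = carlitzCoeff F d 0 ^ Nat.card F ^ k := by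
  induction k with
  | zero => rw [pow_zero, powerSum_one, pow_one]
  | succ k ih => rw [pow_succ', powerSum_card_mul, ih, ← pow_mul, mul_comm]

theorem powerSum_zero_right {d : ℕ} (hd : d ≠ 0) : powerSum F d 0 = 0 := by
  simp [powerSum, card_monics, natCard_cast_ratFunc, hd]

theorem lowerPowerSum_zero_right (d : ℕ) : lowerPowerSum F (d + 1) 0 = 1 := by
  rw [lowerPowerSum, Finset.sum_range_succ', Finset.sum_eq_zero fun i _ =>
    powerSum_zero_right F i.succ_ne_zero, zero_add]
  simp [powerSum, card_monics]

/-- As `c ^ j = 1` for the nonzero constants `c`, this is up to the factor `q - 1 = -1` the sum over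
all nonzero polynomials of degree less than `d`. -/
theorem sum_lowerMonics_pow_eq_zero {d j : ℕ} (hj0 : j ≠ 0) (hdvd : Nat.card F - 1 ∣ j)
    (hj : j + 1 < Nat.card F ^ d) :
    ∑ a ∈ lowerMonics F d, algebraMap F[X] (RatFunc F) a ^ j = 0 := by
  classical
  have := Fintype.ofFinite F
  have hpow (c : F) (hc : c ≠ 0) : c ^ j = 1 := by
    obtain ⟨e, rfl⟩ := hdvd
    rw [pow_mul, Nat.card_eq_fintype_card, FiniteField.pow_card_sub_one_eq_one c hc, one_pow]
  have h1 : ∑ a ∈ (polysLT F d).erase 0, algebraMap F[X] (RatFunc F) a ^ j =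
      ∑ x ∈ (Finset.univ.erase (0 : F)) ×ˢ lowerMonics F d,
        algebraMap F[X] (RatFunc F) x.2 ^ j := by
    refine Finset.sum_bij' (fun a _ => (a.leadingCoeff, C a.leadingCoeff⁻¹ * a))
      (fun x _ => C x.1 * x.2) ?_ ?_ ?_ ?_ ?_
    · intro a ha
      rw [Finset.mem_erase, mem_polysLT] at ha
      have h0 : a.leadingCoeff ≠ 0 := leadingCoeff_ne_zero.2 ha.1
      rw [Finset.mem_product, mem_lowerMonics, Finset.mem_erase]
      refine ⟨⟨h0, Finset.mem_univ _⟩, ?_, ?_⟩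
      · rw [Monic, leadingCoeff_mul, leadingCoeff_C, inv_mul_cancel₀ h0]
      · rw [natDegree_C_mul (inv_ne_zero h0)]
        exact (natDegree_lt_iff_degree_lt ha.1).2 ha.2
    · intro x hx
      rw [Finset.mem_product, mem_lowerMonics, Finset.mem_erase] at hx
      rw [Finset.mem_erase, mem_polysLT, degree_C_mul hx.1.1]
      exact ⟨mul_ne_zero (C_ne_zero.2 hx.1.1) hx.2.1.ne_zero,
        (natDegree_lt_iff_degree_lt hx.2.1.ne_zero).1 hx.2.2⟩
    · intro a ha
      have h0 : a.leadingCoeff ≠ 0 := leadingCoeff_ne_zero.2 (Finset.mem_erase.1 ha).1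
      rw [← mul_assoc, ← C_mul, mul_inv_cancel₀ h0, C_1, one_mul]
    · intro x hx
      rw [Finset.mem_product, mem_lowerMonics, Finset.mem_erase] at hx
      have h0 : (C x.1 * x.2).leadingCoeff = x.1 := by
        rw [leadingCoeff_mul, leadingCoeff_C, hx.2.1.leadingCoeff, mul_one]
      simp only [h0, ← mul_assoc, ← C_mul, inv_mul_cancel₀ hx.1.1, C_1, one_mul, Prod.mk.eta]
    · intro a ha
      have h0 : a.leadingCoeff ≠ 0 := leadingCoeff_ne_zero.2 (Finset.mem_erase.1 ha).1
      simp only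
      rw [← map_pow, ← map_pow, mul_pow, ← C_pow, hpow _ (inv_ne_zero h0), C_1, one_mul]
  have h2 : ((Finset.univ.erase (0 : F)).card : RatFunc F) = -1 := by
    rw [Finset.card_erase_of_mem (Finset.mem_univ _), Finset.card_univ,
      Nat.cast_sub Fintype.card_pos, ← Nat.card_eq_fintype_card, natCard_cast_ratFunc,
      Nat.cast_one, zero_sub]
  have h3 := sum_polysLT_pow_eq_zero F hj
  rw [← Finset.sum_erase (a := 0) _ (by rw [map_zero, zero_pow hj0]), h1, Finset.sum_product]
    at h3
  simp only [Finset.sum_const, nsmul_eq_mul, h2] at h3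
  simpa using h3

/-! ### Recursions for the power sums -/

/-- The identity `E_d(a) = 1`, summed over the monic `a` of degree `d`. -/
theorem sum_carlitzCoeff_mul_powerSum (d M n : ℕ) (hM : 2 ≤ M)
    (hlt : ∀ i < n, Nat.card F ^ i < M) (hle : M ≤ Nat.card F ^ n) :
    ∑ i ∈ Finset.range n, carlitzCoeff F d i * powerSum F d (M - Nat.card F ^ i) =
      powerSum F d M := by
  refine (sum_mul_sum_one_div_pow (fun i hi => carlitzCoeff_eq_zero F hi)
    (fun a ha => ((mem_monics F).1 ha).1.ne_zero) (fun i hi => (hlt i hi).le) ?_).trans ?_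
  · intro i hn hd
    have h1 := Nat.pow_le_pow_right (Nat.card_pos (α := F)) hn
    have h2 := Nat.pow_le_pow_right (Nat.card_pos (α := F)) hd
    exact ⟨by omega, sum_monics_pow_eq_zero F (by omega)⟩
  · refine Finset.sum_congr rfl fun a ha => ?_
    obtain ⟨h1, h2⟩ := (mem_monics F).1 ha
    rw [← eval_carlitzPoly, eval_carlitzPoly_algebraMap F h2.le, ← h2, coeff_natDegree,
      h1.leadingCoeff, map_one]

theorem sum_mul_lowerPowerSum {d M n : ℕ} {c : ℕ → RatFunc F} (hc : ∀ i, d < i → c i = 0)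
    (hM : 2 ≤ M) (hmod : M ≡ 1 [MOD Nat.card F - 1]) (hle : ∀ i < n, Nat.card F ^ i ≤ M)
    (hlt : M < Nat.card F ^ n) :
    ∑ i ∈ Finset.range n, c i * lowerPowerSum F d (M - Nat.card F ^ i) =
      ∑ a ∈ lowerMonics F d, (∑ i ∈ Finset.range (d + 1),
        c i * algebraMap F[X] (RatFunc F) a ^ Nat.card F ^ i) /
          algebraMap F[X] (RatFunc F) a ^ M := by
  simp only [lowerPowerSum_eq_sum]
  refine sum_mul_sum_one_div_pow hc (fun a ha => ((mem_lowerMonics F).1 ha).1.ne_zero) hle ?_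
  intro i hn hd
  have h1 := Nat.pow_le_pow_right (Nat.card_pos (α := F)) hn
  have h2 := Nat.pow_le_pow_right (Nat.card_pos (α := F)) hd
  have h3 : Nat.card F ^ i ≡ 1 [MOD Nat.card F - 1] := pow_modEq_one_mod_sub_one Nat.card_pos i
  exact ⟨by omega, sum_lowerMonics_pow_eq_zero F (by omega)
    ((Nat.modEq_iff_dvd' (by omega)).1 (hmod.trans h3.symm)) (by omega)⟩

/-- The identity `E_d(a) = 0`, summed over the monic `a` of degree less than `d`. -/
theorem sum_carlitzCoeff_mul_lowerPowerSum (d M n : ℕ) (hM : 2 ≤ M)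
    (hmod : M ≡ 1 [MOD Nat.card F - 1]) (hle : ∀ i < n, Nat.card F ^ i ≤ M)
    (hlt : M < Nat.card F ^ n) :
    ∑ i ∈ Finset.range n, carlitzCoeff F d i * lowerPowerSum F d (M - Nat.card F ^ i) = 0 := by
  rw [sum_mul_lowerPowerSum F (fun i hi => carlitzCoeff_eq_zero F hi) hM hmod hle hlt]
  refine Finset.sum_eq_zero fun a ha => ?_
  obtain ⟨-, h2⟩ := (mem_lowerMonics F).1 ha
  rw [← eval_carlitzPoly, eval_carlitzPoly_algebraMap F h2.le, coeff_eq_zero_of_natDegree_lt h2,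
    map_zero, zero_div]

/-- The value of `E_{d + 1}(t a)`, which is `1` if `a` has degree `d` and `0` if it has lower degree,
summed over the monic `a` of degree at most `d`. -/
theorem sum_carlitzCoeff_mul_X_pow_mul_lowerPowerSum (d M n : ℕ) (hM : 2 ≤ M)
    (hmod : M ≡ 1 [MOD Nat.card F - 1]) (hle : ∀ i < n, Nat.card F ^ i ≤ M)
    (hlt : M < Nat.card F ^ n) :
    ∑ i ∈ Finset.range n, carlitzCoeff F (d + 1) i * RatFunc.X ^ Nat.card F ^ i *
      lowerPowerSum F (d + 1) (M - Nat.card F ^ i) = powerSum F d M := by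
  rw [sum_mul_lowerPowerSum F (fun i hi => by rw [carlitzCoeff_eq_zero F hi, zero_mul])
    hM hmod hle hlt]
  simp only [mul_assoc, ← mul_pow]
  have h (a : F[X]) (ha : a ∈ lowerMonics F (d + 1)) :
      ∑ i ∈ Finset.range (d + 1 + 1), carlitzCoeff F (d + 1) i *
        (RatFunc.X * algebraMap F[X] (RatFunc F) a) ^ Nat.card F ^ i =
      algebraMap F (RatFunc F) (a.coeff d) := by
    have hd := ((mem_lowerMonics F).1 ha).2
    rw [← eval_carlitzPoly, ← RatFunc.algebraMap_X, ← map_mul, eval_carlitzPoly_algebraMap F,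
      coeff_X_mul]
    rw [natDegree_X_mul ((mem_lowerMonics F).1 ha).1.ne_zero]
    omega
  rw [Finset.sum_congr rfl fun a ha => by rw [h a ha], sum_lowerMonics, Finset.sum_range_succ,
    Finset.sum_eq_zero, zero_add, powerSum]
  · refine Finset.sum_congr rfl fun a ha => ?_
    obtain ⟨h1, h2⟩ := (mem_monics F).1 ha
    rw [← h2, coeff_natDegree, h1.leadingCoeff, map_one]
  · refine fun i hi => Finset.sum_eq_zero fun a ha => ?_
    rw [coeff_eq_zero_of_natDegree_lt, map_zero, zero_div]
    rw [((mem_monics F).1 ha).2]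
    exact Finset.mem_range.1 hi

/-! ### Interchanging the exponents -/

/-- `S_d(q ^ k - q ^ l)` and `S_{<d}(q ^ k - q ^ l)` differ by `[k - l] ^ q ^ l`, up to a factor that
does not depend on `l`. -/
theorem bracket_pow_mul_powerSum (d k l : ℕ) (hl : l < k) :
    bracket F (d + 1) ^ Nat.card F ^ k * powerSum F (d + 1) (Nat.card F ^ k - Nat.card F ^ l) =
      bracket F (k - l) ^ Nat.card F ^ l *
        lowerPowerSum F (d + 1) (Nat.card F ^ k - Nat.card F ^ l) := by
  obtain ⟨φ, hφ⟩ := exists_ringHom_pow_card F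
  have hq := one_lt_natCard_field F
  have h2 (k : ℕ) (hk : 1 ≤ k) : 2 ≤ Nat.card F ^ k :=
    hq.trans_le (by simpa using Nat.pow_le_pow_right hq.le hk)
  have hmod (k : ℕ) : Nat.card F ^ k ≡ 1 [MOD Nat.card F - 1] :=
    pow_modEq_one_mod_sub_one hq.le k
  have hle (k : ℕ) : ∀ i < k + 1, Nat.card F ^ i ≤ Nat.card F ^ k := fun i hi =>
    Nat.pow_le_pow_right hq.le (by omega)
  rw [bracket_pow_card_pow F (k - l), Nat.sub_add_cancel hl.le]
  refine map_pow_sub_pow_mul (carlitzCoeff_zero_ne_zero F (d + 1)) hφ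
    (lowerPowerSum_card_mul F (d + 1)) (powerSum_card_mul F (d + 1)) ?_ ?_ ?_ k l hl
  · exact fun k hk => sum_carlitzCoeff_mul_powerSum F _ _ _ (h2 k hk)
      (fun i hi => Nat.pow_lt_pow_right hq hi) le_rfl
  · exact fun k hk => sum_carlitzCoeff_mul_lowerPowerSum F _ _ _ (h2 k hk) (hmod k) (hle k)
      (Nat.pow_lt_pow_right hq k.lt_succ_self)
  · intro k hk
    rw [sum_carlitzCoeff_mul_X_pow_mul_lowerPowerSum F _ _ _ (h2 k hk) (hmod k) (hle k)
      (Nat.pow_lt_pow_right hq k.lt_succ_self), powerSum_card_pow, powerSum_card_pow, ← mul_pow,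
      bracket_mul_carlitzCoeff_zero, neg_pow_card_pow, neg_neg]

/-- The symmetry of the multizeta values, term by term: both factors split into products over `A`,
`B` and `R`, and by `bracket_pow_mul_powerSum` the factors of `S_d` are those of `S_{<d}` up to
brackets. For `d = 0` both sides vanish. -/
theorem powerSum_mul_lowerPowerSum_swap (d k : ℕ) {A B R : Multiset ℕ} (hAB : A.card = B.card)
    (hAq : A.card < Nat.card F) (hARq : A.card + R.card ≤ Nat.card F) (hA : ∀ l ∈ A, l < k)
    (hB : ∀ l ∈ B, l < k) (hR : ∀ l ∈ R, l < k) :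
    powerSum F d (Nat.card F ^ k - (A.map fun l => Nat.card F ^ l).sum) *
        lowerPowerSum F d ((B + R).map fun l => Nat.card F ^ k - Nat.card F ^ l).sum *
        (B.map fun l => bracket F (k - l) ^ Nat.card F ^ l).prod =
      powerSum F d (Nat.card F ^ k - (B.map fun l => Nat.card F ^ l).sum) *
        lowerPowerSum F d ((A + R).map fun l => Nat.card F ^ k - Nat.card F ^ l).sum *
        (A.map fun l => bracket F (k - l) ^ Nat.card F ^ l).prod := by
  cases d with
  | zero => simp [lowerPowerSum]
  | succ d =>
    have hq := one_lt_natCard_field F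
    set h := powerSum F (d + 1) (Nat.card F ^ k) with hh
    have hh0 : h ≠ 0 := by
      rw [hh, powerSum_card_pow]
      exact pow_ne_zero _ (carlitzCoeff_zero_ne_zero F _)
    set b := bracket F (d + 1) ^ Nat.card F ^ k
    have hb0 : b ≠ 0 := pow_ne_zero _ (bracket_ne_zero F d.succ_ne_zero)
    have hup {A : Multiset ℕ} (hAq : A.card < Nat.card F) (hA : ∀ l ∈ A, l < k) :
        powerSum F (d + 1) (Nat.card F ^ k - (A.map fun l => Nat.card F ^ l).sum) *
          (h * b) ^ A.card = h * ((A.map fun l => bracket F (k - l) ^ Nat.card F ^ l).prod *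
            (A.map fun l =>
              lowerPowerSum F (d + 1) (Nat.card F ^ k - Nat.card F ^ l)).prod) := by
      have h1 := map_pow_sub_sum_mul_pow hq (carlitzCoeff_zero_ne_zero F (d + 1))
        (powerSum_card_mul F (d + 1)) (sum_carlitzCoeff_mul_powerSum F (d + 1)) k A hAq hA
      rw [mul_pow, ← mul_assoc, h1, ← Multiset.prod_map_mul, ← Multiset.map_congr rfl fun l hl =>
        bracket_pow_mul_powerSum F d k l (hA l hl), Multiset.prod_map_mul, Multiset.map_const',
        Multiset.prod_replicate]
      ring
    have hlow {A : Multiset ℕ} (hAq : A.card ≤ Nat.card F) (hA : ∀ l ∈ A, l < k) :=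
      map_sum_pow_sub_pow_eq_prod hq (carlitzCoeff_zero_ne_zero F (d + 1))
        (lowerPowerSum_zero_right F d) (lowerPowerSum_card_mul F (d + 1))
        (sum_carlitzCoeff_mul_lowerPowerSum F (d + 1)) k A hAq fun l hl => (hA l hl).le
    have hA1 := hup hAq hA
    have hB1 := hup (hAB ▸ hAq) hB
    rw [← hAB] at hB1
    rw [hlow (by rwa [Multiset.card_add]) fun l hl => (Multiset.mem_add.1 hl).elim (hA l) (hR l),
      hlow (by rwa [Multiset.card_add, ← hAB]) fun l hl =>
        (Multiset.mem_add.1 hl).elim (hB l) (hR l)]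
    simp only [Multiset.map_add, Multiset.prod_add]
    refine mul_right_cancel₀ (pow_ne_zero A.card (mul_ne_zero hh0 hb0)) ?_
    set gA := (A.map fun l => lowerPowerSum F (d + 1) (Nat.card F ^ k - Nat.card F ^ l)).prod
    set gB := (B.map fun l => lowerPowerSum F (d + 1) (Nat.card F ^ k - Nat.card F ^ l)).prod
    set gR := (R.map fun l => lowerPowerSum F (d + 1) (Nat.card F ^ k - Nat.card F ^ l)).prod
    set bA := (A.map fun l => bracket F (k - l) ^ Nat.card F ^ l).prod
    set bB := (B.map fun l => bracket F (k - l) ^ Nat.card F ^ l).prod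
    linear_combination gB * gR * bB * hA1 - gA * gR * bA * hB1

theorem multizeta_swap [DecidableEq (RatFunc F)] (k : ℕ) {A B R : Multiset ℕ}
    (hAB : A.card = B.card)
    (hAq : A.card < Nat.card F) (hARq : A.card + R.card ≤ Nat.card F) (hA : ∀ l ∈ A, l < k)
    (hB : ∀ l ∈ B, l < k) (hR : ∀ l ∈ R, l < k) :
    multizeta F [Nat.card F ^ k - (A.map fun l => Nat.card F ^ l).sum,
        ((B + R).map fun l => Nat.card F ^ k - Nat.card F ^ l).sum] =
      algebraMap (RatFunc F) (RatFunc.CompletionAtInfty F)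
          ((A.map fun l => bracket F (k - l) ^ Nat.card F ^ l).prod /
            (B.map fun l => bracket F (k - l) ^ Nat.card F ^ l).prod) *
        multizeta F [Nat.card F ^ k - (B.map fun l => Nat.card F ^ l).sum,
          ((A + R).map fun l => Nat.card F ^ k - Nat.card F ^ l).sum] := by
  rw [multizeta, multizeta, ← tsum_mul_left]
  refine tsum_congr fun d => ?_
  rw [← map_mul]
  congr 1
  have hB0 : (B.map fun l => bracket F (k - l) ^ Nat.card F ^ l).prod ≠ 0 := by
    refine Multiset.prod_ne_zero fun h => ?_
    obtain ⟨l, hl, h⟩ := Multiset.mem_map.1 h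
    exact pow_ne_zero _ (bracket_ne_zero F (Nat.sub_ne_zero_of_lt (hB l hl))) h
  have := powerSum_mul_lowerPowerSum_swap F d k hAB hAq hARq hA hB hR
  rw [div_mul_eq_mul_div, eq_div_iff hB0, mul_comm (Multiset.prod _)]
  exact this

end

end CarlitzMZV

open CarlitzMZV Finset in
theorem theorem1 (F : Type*) [Field F] [Finite F] [DecidableEq (RatFunc F)]
    (q : ℕ) (hq : Nat.card F = q) :
    (∀ n k : ℕ, 1 ≤ k →
      multizeta F [q ^ (n + k) - q ^ n, q ^ (n + k) - 1] =
        algebraMap (RatFunc F) (RatFunc.CompletionAtInfty F)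
            (bracket F k ^ q ^ n / bracket F (n + k)) *
          multizeta F [q ^ (n + k) - 1, q ^ (n + k) - q ^ n]) ∧
    (∀ (k s : ℕ) (κ l : ℕ → ℕ), 1 ≤ k → 1 ≤ s → s < q →
      (∀ i ∈ Icc 1 s, κ i < k) → (∀ i ∈ Icc 1 s, l i < k) →
      multizeta F [q ^ k - ∑ i ∈ Icc 1 s, q ^ κ i, s * q ^ k - ∑ i ∈ Icc 1 s, q ^ l i] =
        algebraMap (RatFunc F) (RatFunc.CompletionAtInfty F)
            (∏ i ∈ Icc 1 s, bracket F (k - κ i) ^ q ^ κ i / bracket F (k - l i) ^ q ^ l i) *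
          multizeta F [q ^ k - ∑ i ∈ Icc 1 s, q ^ l i, s * q ^ k - ∑ i ∈ Icc 1 s, q ^ κ i]) ∧
    (∀ (k s₁ s₂ : ℕ) (κ l : ℕ → ℕ), 1 ≤ k → 1 ≤ s₁ → s₁ ≤ s₂ → s₂ ≤ q → s₁ ≠ q →
      (∀ i ∈ Icc 1 s₁, κ i < k) → (∀ j ∈ Icc 1 s₂, l j < k) →
      multizeta F [q ^ k - ∑ i ∈ Icc 1 s₁, q ^ κ i, s₂ * q ^ k - ∑ j ∈ Icc 1 s₂, q ^ l j] =
        algebraMap (RatFunc F) (RatFunc.CompletionAtInfty F)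
            (∏ i ∈ Icc 1 s₁, bracket F (k - κ i) ^ q ^ κ i / bracket F (k - l i) ^ q ^ l i) *
          multizeta F [q ^ k - ∑ i ∈ Icc 1 s₁, q ^ l i,
            s₂ * q ^ k - ∑ j ∈ Icc 1 s₁, q ^ κ j - ∑ j ∈ Icc (s₁ + 1) s₂, q ^ l j]) := by
  subst hq
  have hq := one_lt_natCard_field F
  have hsub (k : ℕ) (s : Finset ℕ) (f : ℕ → ℕ) (hf : ∀ i ∈ s, f i < k) :
      ∑ i ∈ s, (Nat.card F ^ k - Nat.card F ^ f i) + ∑ i ∈ s, Nat.card F ^ f i =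
        #s * Nat.card F ^ k := by
    rw [← sum_add_distrib, sum_congr rfl fun i hi =>
      Nat.sub_add_cancel (Nat.pow_le_pow_right hq.le (hf i hi).le), sum_const, smul_eq_mul]
  have part3 (k s₁ s₂ : ℕ) (κ l : ℕ → ℕ) (h12 : s₁ ≤ s₂) (h2 : s₂ ≤ Nat.card F)
      (h1 : s₁ ≠ Nat.card F) (hκ : ∀ i ∈ Icc 1 s₁, κ i < k) (hl : ∀ j ∈ Icc 1 s₂, l j < k) :
      multizeta F [Nat.card F ^ k - ∑ i ∈ Icc 1 s₁, Nat.card F ^ κ i,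
          s₂ * Nat.card F ^ k - ∑ j ∈ Icc 1 s₂, Nat.card F ^ l j] =
        algebraMap (RatFunc F) (RatFunc.CompletionAtInfty F)
            (∏ i ∈ Icc 1 s₁, bracket F (k - κ i) ^ Nat.card F ^ κ i /
              bracket F (k - l i) ^ Nat.card F ^ l i) *
          multizeta F [Nat.card F ^ k - ∑ i ∈ Icc 1 s₁, Nat.card F ^ l i,
            s₂ * Nat.card F ^ k - ∑ j ∈ Icc 1 s₁, Nat.card F ^ κ j -
              ∑ j ∈ Icc (s₁ + 1) s₂, Nat.card F ^ l j] := by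
    have hl₁ : ∀ j ∈ Icc 1 s₁, l j < k := fun j hj => hl j (by rw [mem_Icc] at *; omega)
    have hl₂ : ∀ j ∈ Icc (s₁ + 1) s₂, l j < k := fun j hj => hl j (by rw [mem_Icc] at *; omega)
    have hmem {s : Finset ℕ} (f : ℕ → ℕ) (hf : ∀ i ∈ s, f i < k) : ∀ m ∈ s.val.map f, m < k :=
      fun m hm => by
        obtain ⟨i, hi, rfl⟩ := Multiset.mem_map.1 hm
        exact hf i hi
    have key := multizeta_swap F k (A := (Icc 1 s₁).val.map κ) (B := (Icc 1 s₁).val.map l)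
      (R := (Icc (s₁ + 1) s₂).val.map l) (by simp) (by simpa using by omega)
      (by simpa using by omega) (hmem κ hκ) (hmem l hl₁) (hmem l hl₂)
    simp only [Multiset.map_add, Multiset.map_map, Function.comp_def, Multiset.sum_add] at key
    change multizeta F [Nat.card F ^ k - ∑ i ∈ Icc 1 s₁, Nat.card F ^ κ i,
        ∑ i ∈ Icc 1 s₁, (Nat.card F ^ k - Nat.card F ^ l i) +
          ∑ i ∈ Icc (s₁ + 1) s₂, (Nat.card F ^ k - Nat.card F ^ l i)] =
      algebraMap (RatFunc F) (RatFunc.CompletionAtInfty F)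
        ((∏ i ∈ Icc 1 s₁, bracket F (k - κ i) ^ Nat.card F ^ κ i) /
          ∏ i ∈ Icc 1 s₁, bracket F (k - l i) ^ Nat.card F ^ l i) *
      multizeta F [Nat.card F ^ k - ∑ i ∈ Icc 1 s₁, Nat.card F ^ l i,
        ∑ i ∈ Icc 1 s₁, (Nat.card F ^ k - Nat.card F ^ κ i) +
          ∑ i ∈ Icc (s₁ + 1) s₂, (Nat.card F ^ k - Nat.card F ^ l i)] at key
    have e1 := hsub k _ κ hκ
    have e2 := hsub k _ l hl₁
    have e3 := hsub k _ l hl₂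
    have e4 : ∑ j ∈ Icc 1 s₂, Nat.card F ^ l j =
        ∑ j ∈ Icc 1 s₁, Nat.card F ^ l j + ∑ j ∈ Icc (s₁ + 1) s₂, Nat.card F ^ l j := by
      rw [← sum_union]
      · refine sum_congr ?_ fun _ _ => rfl
        ext j
        simp only [mem_union, mem_Icc]
        omega
      · exact disjoint_left.2 fun j h1 h2 => by rw [mem_Icc] at *; omega
    have e5 : s₂ * Nat.card F ^ k = s₁ * Nat.card F ^ k + (s₂ - s₁) * Nat.card F ^ k := by
      rw [← add_mul, Nat.add_sub_cancel' h12]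
    simp only [Nat.card_Icc, Nat.add_sub_cancel, Nat.add_sub_add_right] at e1 e2 e3
    rw [prod_div_distrib]
    convert key using 4
    · omega
    · congr 1
      omega
  refine ⟨fun n k hk => ?_, fun k s κ l _ _ hs hκ hl => ?_,
    fun k s₁ s₂ κ l _ _ h12 h2 h1 hκ hl => part3 k s₁ s₂ κ l h12 h2 h1 hκ hl⟩
  · simpa using part3 (n + k) 1 1 (fun _ => n) (fun _ => 0) le_rfl hq.le hq.ne
      (fun _ _ => by omega) (fun _ _ => by omega)
  · simpa using part3 k s s κ l le_rfl hs.le hs.ne hκ hl
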